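/- Let $\mathcal A$ be a commutative (not necessarily unital) $C^*$-algebra and let $E$ be a Hilbert $C^*$-module over $\mathcal A$ which is finitely generated, i.e. there are finitely many $f_1,\dots,f_N\in E$ such that $f_1\mathcal A+\dots+f_N\mathcal A$ is dense in $E$ (in particular this covers the case where $f_1,\dots,f_N$ generate $E$ algebraically). For a densely defined linear operator $T$ in $E$ let $T^*$ denote its adjoint: $\operatorname{dom}(T^*)$ is the set of all $y\in E$ for which there is a $z\in E$ with $\langle Tx,y\rangle=\langle x,z\rangle$ for all $x\in\operatorname{dom}(T)$, and $T^*y=z$. The operator $T$ is called semiregular if $\operatorname{dom}(T)$ is a dense $\mathcal A$-submodule of $E$ and $T^*$ is densely defined. A closed semiregular operator $T$ is called regular if $I+T^*T$ has dense range. Then every semiregular operator $T$ in $E$ is closable and its closure $\overline T$ is regular. In particular, every closed semiregular operator in $E$ is regular. -/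

import Mathlib

open scoped InnerProductSpace

namespace HilbertModule

section Defs

variable (A : Type*) {E : Type*} [NonUnitalCommCStarAlgebra A] [PartialOrder A] [StarOrderedRing A]
  [NormedAddCommGroup E] [NormedSpace ℂ E] [SMul A E] [CStarModule A E]

variable (E) in
/-- `E` is (topologically) finitely generated over `A`: for some finite family `f₁, …, fₙ` in `E`,
the submodule `f₁ A + ⋯ + fₙ A` is dense in `E`. -/
def IsFinitelyGenerated : Prop :=
  ∃ (n : ℕ) (f : Fin n → E), Dense (Set.range fun a : Fin n → A => ∑ i, a i • f i)

/-- The graph of the adjoint of an operator `T` in `E`: all pairs `(y, z)` with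
`⟪T x, y⟫ = ⟪x, z⟫` for all `x ∈ dom T`. -/
def adjointGraph (T : E →ₗ.[ℂ] E) : Submodule ℂ (E × E) where
  carrier := {p | ∀ x : T.domain, ⟪T x, p.1⟫_A = ⟪(x : E), p.2⟫_A}
  add_mem' := by
    intro p q hp hq x
    simp [hp x, hq x]
  zero_mem' := by
    intro x
    rw [Prod.fst_zero, Prod.snd_zero, CStarModule.inner_zero_right, CStarModule.inner_zero_right]
  smul_mem' := by
    intro c p hp x
    simp [hp x]

/-- The adjoint `T*` of an operator `T` in `E`. Its domain consists of all `y` for which there is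
some `z` with `⟪T x, y⟫ = ⟪x, z⟫` for all `x ∈ dom T`; if `T` is densely defined then this `z` is
unique, and `T* y = z`. -/
noncomputable def adjoint (T : E →ₗ.[ℂ] E) : E →ₗ.[ℂ] E :=
  (adjointGraph A T).toLinearPMap

/-- A semiregular operator in `E`: its domain is a dense `A`-submodule of `E`, and its adjoint is
densely defined. -/
structure IsSemiregular (T : E →ₗ.[ℂ] E) : Prop where
  smul_mem : ∀ (a : A) (x : E), x ∈ T.domain → a • x ∈ T.domain
  dense_domain : Dense (T.domain : Set E)
  dense_adjoint_domain : Dense ((adjoint A T).domain : Set E)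

/-- The range of `I + T* T`, where `dom (T* T) = {x ∈ dom T | T x ∈ dom T*}`. -/
def rangeOneAddAdjointComp (T : E →ₗ.[ℂ] E) : Set E :=
  {w | ∃ (x : T.domain) (h : T x ∈ (adjoint A T).domain), (x : E) + adjoint A T ⟨T x, h⟩ = w}

/-- A regular operator in `E`: a closed semiregular operator `T` such that `I + T* T` has dense
range. -/
structure IsRegular (T : E →ₗ.[ℂ] E) : Prop where
  isClosed : T.IsClosed
  isSemiregular : IsSemiregular A T
  dense_range : Dense (rangeOneAddAdjointComp A T)

end Defs

end HilbertModule

/-! Regularity follows once the graph of a closed `T` and the rotated graph `{(T* y, -y)}` together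
span `E × E`. They are orthogonal and closed, so their sum is closed
(`sup_eq_top_of_dense_of_inner_eq_zero`) and only its density is at stake. Density can be tested
fibrewise. Each character `χ` of `A` turns `E` into a Hilbert space, finite-dimensional because `E`
is finitely generated, and a partition of unity glues fibrewise approximations
(`dense_of_forall_map_toFiber_eq_top`). In a finite-dimensional fibre, dense subspaces of `E` have
full image, so both domains fill the fibre and the two graphs leave no orthogonal complement
(`map_toFiber_graph_sup_eq_top`). -/

namespace HilbertModule

open scoped ComplexOrder

/-! ### Localization at a character. -/

section Fiber

variable {A : Type*} [NonUnitalCommCStarAlgebra A] [PartialOrder A]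

/-- The module `E`, to be equipped with the semi-inner product `χ ⟪x, y⟫`. -/
@[nolint unusedArguments]
def PreFiber (_χ : A →⋆ₙₐ[ℂ] ℂ) (E : Type*) := E

variable (χ : A →⋆ₙₐ[ℂ] ℂ) {E : Type*} [NormedAddCommGroup E] [NormedSpace ℂ E]

instance : AddCommGroup (PreFiber χ E) := inferInstanceAs (AddCommGroup E)
instance : Module ℂ (PreFiber χ E) := inferInstanceAs (Module ℂ E)

/-- The identity map from the module to its localization. -/
def toPreFiber : E ≃ₗ[ℂ] PreFiber χ E := LinearEquiv.refl ℂ _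

variable [StarOrderedRing A] [SMul A E] [CStarModule A E]

theorem apply_nonneg {a : A} (ha : 0 ≤ a) : 0 ≤ χ a := by
  rw [StarOrderedRing.nonneg_iff] at ha
  induction ha using AddSubmonoid.closure_induction with
  | mem x hx =>
    obtain ⟨s, rfl⟩ := hx
    rw [map_mul, map_star]
    exact star_mul_self_nonneg _
  | zero => simp
  | add x y _ _ hx hy => rw [map_add]; exact add_nonneg hx hy

/-- The semi-inner product `χ ⟪x, y⟫`. -/
noncomputable abbrev preFiberCore : PreInnerProductSpace.Core ℂ (PreFiber χ E) where
  inner x y := χ ⟪(toPreFiber χ).symm x, (toPreFiber χ).symm y⟫_A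
  conj_inner_symm x y := by
    rw [← Complex.star_def, ← map_star, CStarModule.star_inner]
  re_inner_nonneg x := (RCLike.nonneg_iff.mp
    (apply_nonneg χ (CStarModule.inner_self_nonneg (x := (toPreFiber χ).symm x)))).1
  add_left x y z := by simp
  smul_left x y c := by simp

noncomputable instance : SeminormedAddCommGroup (PreFiber χ E) :=
  InnerProductSpace.Core.toSeminormedAddCommGroup (c := preFiberCore χ)
noncomputable instance : InnerProductSpace ℂ (PreFiber χ E) :=
  InnerProductSpace.ofCore (preFiberCore χ)

/-- The localization of a Hilbert module at a character. -/
abbrev Fiber (E : Type*) [NormedAddCommGroup E] [NormedSpace ℂ E] [SMul A E] [CStarModule A E] :=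
  SeparationQuotient (PreFiber χ E)

variable (E) in
/-- The map from a Hilbert module to its localization at a character. -/
noncomputable def toFiber : E →ₗ[ℂ] Fiber χ E :=
  (SeparationQuotient.mkCLM ℂ (PreFiber χ E)).toLinearMap ∘ₗ (toPreFiber χ).toLinearMap

theorem toFiber_surjective : Function.Surjective (toFiber χ E) :=
  SeparationQuotient.surjective_mk.comp (toPreFiber χ).surjective

@[simp]
theorem inner_toFiber (x y : E) : ⟪toFiber χ E x, toFiber χ E y⟫_ℂ = χ ⟪x, y⟫_A := rfl

theorem norm_toFiber_sq (x : E) : ‖toFiber χ E x‖ ^ 2 = ‖χ ⟪x, x⟫_A‖ := by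
  rw [← inner_toFiber, inner_self_eq_norm_sq_to_K]
  simp

theorem norm_toFiber_le (x : E) : ‖toFiber χ E x‖ ≤ ‖x‖ := by
  rw [← sq_le_sq₀ (norm_nonneg _) (norm_nonneg _), norm_toFiber_sq, CStarModule.norm_sq_eq A]
  exact NonUnitalStarAlgHom.norm_apply_le χ _

theorem continuous_toFiber : Continuous (toFiber χ E) :=
  AddMonoidHomClass.continuous_of_bound (toFiber χ E) 1 fun x => by
    simpa using norm_toFiber_le χ x

@[simp]
theorem toFiber_smul (a : A) (x : E) : toFiber χ E (a • x) = χ a • toFiber χ E x := by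
  refine ext_inner_left ℂ fun v => ?_
  obtain ⟨y, rfl⟩ := toFiber_surjective χ v
  simp [inner_smul_right]

/-- The image is dense, and subspaces of a finite-dimensional space are closed. -/
theorem map_toFiber_eq_top_of_dense [FiniteDimensional ℂ (Fiber χ E)] {M : Submodule ℂ E}
    (hM : Dense (M : Set E)) : M.map (toFiber χ E) = ⊤ := by
  have hc : IsClosed ((M.map (toFiber χ E) : Submodule ℂ (Fiber χ E)) : Set (Fiber χ E)) :=
    Submodule.closed_of_finiteDimensional _
  refine SetLike.coe_injective ?_
  rw [← hc.closure_eq, Submodule.map_coe, Submodule.top_coe]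
  exact ((toFiber_surjective χ).denseRange.dense_image (continuous_toFiber χ) hM).closure_eq

/-- In the fibre, coefficients from `A` act as complex scalars, so the complex span of the
generators already has dense, hence full, image. -/
theorem map_toFiber_span_eq_top {ι : Type*} [Fintype ι] {f : ι → E}
    (hf : Dense (Set.range fun a : ι → A => ∑ i, a i • f i)) :
    (Submodule.span ℂ (Set.range f)).map (toFiber χ E) = ⊤ := by
  set K := (Submodule.span ℂ (Set.range f)).map (toFiber χ E) with hK
  have : FiniteDimensional ℂ (Submodule.span ℂ (Set.range f)) :=
    FiniteDimensional.span_of_finite ℂ (Set.finite_range f)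
  have hc : IsClosed (K : Set (Fiber χ E)) := Submodule.closed_of_finiteDimensional _
  have hcl := ((toFiber_surjective χ).denseRange.dense_image (continuous_toFiber χ) hf).closure_eq
  refine SetLike.coe_injective (Set.univ_subset_iff.mp ?_)
  rw [← hcl]
  refine closure_minimal ?_ hc
  rintro _ ⟨_, ⟨a, rfl⟩, rfl⟩
  simp only [map_sum, toFiber_smul]
  exact K.sum_mem fun i _ => K.smul_mem _
    (Submodule.mem_map_of_mem (Submodule.subset_span (Set.mem_range_self i)))

theorem norm_toFiber_prod_sq (x : (WithCStarModule A (E × E))) :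
    ‖toFiber χ (WithCStarModule A (E × E)) x‖ ^ 2 = ‖toFiber χ E x.1‖ ^ 2 + ‖toFiber χ E x.2‖ ^ 2 := by
  have h : ((‖toFiber χ (WithCStarModule A (E × E)) x‖ ^ 2 : ℝ) : ℂ) =
      ((‖toFiber χ E x.1‖ ^ 2 + ‖toFiber χ E x.2‖ ^ 2 : ℝ) : ℂ) := by
    push_cast
    rw [← Complex.coe_algebraMap, ← inner_self_eq_norm_sq_to_K (𝕜 := ℂ),
      ← inner_self_eq_norm_sq_to_K (𝕜 := ℂ), ← inner_self_eq_norm_sq_to_K (𝕜 := ℂ)]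
    simp only [inner_toFiber, WithCStarModule.prod_inner, map_add]
  exact_mod_cast h

theorem finiteDimensional_fiber_prod {W : Submodule ℂ E} [FiniteDimensional ℂ W]
    (hW : W.map (toFiber χ E) = ⊤) : FiniteDimensional ℂ (Fiber χ (WithCStarModule A (E × E))) := by
  have hlift : ∀ u : E, ∃ w ∈ W, toFiber χ E w = toFiber χ E u := fun u => by
    simpa using hW.ge (Submodule.mem_top (x := toFiber χ E u))
  refine Module.Finite.of_surjective (toFiber χ (WithCStarModule A (E × E)) ∘ₗ
    (WithCStarModule.linearEquiv ℂ A (E × E)).symm.toLinearMap ∘ₗ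
      W.subtype.prodMap W.subtype) fun v => ?_
  obtain ⟨z, rfl⟩ := toFiber_surjective χ v
  obtain ⟨w₁, hw₁, h₁⟩ := hlift z.1
  obtain ⟨w₂, hw₂, h₂⟩ := hlift z.2
  refine ⟨(⟨w₁, hw₁⟩, ⟨w₂, hw₂⟩), ?_⟩
  rw [← sub_eq_zero, LinearMap.comp_apply, ← map_sub, ← norm_eq_zero,
    ← pow_eq_zero_iff (two_ne_zero), norm_toFiber_prod_sq]
  simp [h₁, h₂]

end Fiber

/-! ### From fibrewise to global density, by Gelfand duality. -/

section Density

open WeakDual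

variable {A : Type*} [NonUnitalCommCStarAlgebra A]

/-- The restriction to `A` of a character of the unitization of `A`; it may be zero. -/
noncomputable def restrictCharacter (x : characterSpace ℂ (Unitization ℂ A)) : A →⋆ₙₐ[ℂ] ℂ where
  toFun a := x (a : Unitization ℂ A)
  map_smul' c a := by rw [Unitization.inr_smul, map_smul]; rfl
  map_zero' := by rw [Unitization.inr_zero, map_zero]
  map_add' a b := by rw [Unitization.inr_add, map_add]
  map_mul' a b := by rw [Unitization.inr_mul, map_mul]
  map_star' a := by rw [Unitization.inr_star, map_star]

theorem restrictCharacter_apply (x : characterSpace ℂ (Unitization ℂ A)) (a : A) :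
    restrictCharacter x a = x (a : Unitization ℂ A) := rfl

/-- The Gelfand transform of the unitization is isometric; unitizing also makes the character space
compact. -/
theorem norm_le_of_forall_restrictCharacter {a : A} {C : ℝ} (hC : 0 ≤ C)
    (h : ∀ x, ‖restrictCharacter x a‖ ≤ C) : ‖a‖ ≤ C := by
  rw [← Unitization.norm_inr (𝕜 := ℂ),
    ← (gelfandTransform_isometry (Unitization ℂ A)).norm_map_of_map_zero (map_zero _),
    ContinuousMap.norm_le _ hC]
  exact h

variable [PartialOrder A] [StarOrderedRing A]
  {E : Type*} [NormedAddCommGroup E] [NormedSpace ℂ E] [SMul A E] [CStarModule A E]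

theorem norm_le_of_forall_norm_toFiber_le {u : E} {C : ℝ} (hC : 0 ≤ C)
    (h : ∀ x : characterSpace ℂ (Unitization ℂ A), ‖toFiber (restrictCharacter x) E u‖ ≤ C) :
    ‖u‖ ≤ C := by
  rw [← sq_le_sq₀ (norm_nonneg _) hC, CStarModule.norm_sq_eq A]
  refine norm_le_of_forall_restrictCharacter (sq_nonneg C) fun x => ?_
  rw [← norm_toFiber_sq]
  exact pow_le_pow_left₀ (norm_nonneg _) (h x) 2

theorem continuous_norm_toFiber (u : E) :
    Continuous fun x : characterSpace ℂ (Unitization ℂ A) =>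
      ‖toFiber (restrictCharacter x) E u‖ := by
  have h : (fun x : characterSpace ℂ (Unitization ℂ A) =>
      ‖toFiber (restrictCharacter x) E u‖) =
      fun x => √‖gelfandTransform ℂ (Unitization ℂ A) (⟪u, u⟫_A : A) x‖ := by
    funext x
    rw [← Real.sqrt_sq (norm_nonneg (toFiber _ _ _)), norm_toFiber_sq]
    rfl
  rw [h]
  fun_prop

variable (A) in
theorem toFiber_unitization_smul (b : Unitization ℂ A)
    (x : characterSpace ℂ (Unitization ℂ A)) (u : E) :
    toFiber (restrictCharacter x) E (b.fst • u + b.snd • u) =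
      x b • toFiber (restrictCharacter x) E u := by
  have hb : x b = b.fst + restrictCharacter x b.snd := by
    conv_lhs => rw [← Unitization.inl_fst_add_inr_snd_eq b]
    rw [map_add, restrictCharacter_apply]
    congr 1
    exact AlgHomClass.commutes x b.fst
  rw [map_add, map_smul, toFiber_smul, hb, add_smul]

/-- An `A`-submodule that surjects onto every localization is dense. -/
theorem dense_of_forall_map_toFiber_eq_top {M : Submodule ℂ E}
    (hM : ∀ (a : A), ∀ u ∈ M, a • u ∈ M)
    (h : ∀ χ : A →⋆ₙₐ[ℂ] ℂ, M.map (toFiber χ E) = ⊤) : Dense (M : Set E) := by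
  intro e
  rw [Metric.mem_closure_iff]
  intro δ hδ
  obtain ⟨ε, hε, hεδ⟩ := exists_between hδ
  let U : M → Set (characterSpace ℂ (Unitization ℂ A)) := fun m =>
    {x | ‖toFiber (restrictCharacter x) E (e - m)‖ < ε}
  have hUo : ∀ m, IsOpen (U m) := fun m =>
    isOpen_lt (continuous_norm_toFiber _) continuous_const
  have hUc : Set.univ ⊆ ⋃ m, U m := fun x _ => by
    obtain ⟨m, hm, hme⟩ := (h (restrictCharacter x)).ge
      (Submodule.mem_top (x := toFiber (restrictCharacter x) E e))
    refine Set.mem_iUnion.mpr ⟨⟨m, hm⟩, ?_⟩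
    simpa [U, hme] using hε
  obtain ⟨t, ht⟩ := isCompact_univ.elim_finite_subcover U hUo hUc
  obtain ⟨f, hf⟩ := PartitionOfUnity.exists_isSubordinate isClosed_univ (fun m : t => U m)
    (fun m => hUo m) (by simpa [Set.iUnion_subtype] using ht)
  -- Surjectivity of the Gelfand transform realizes the partition functions as elements of the
  -- unitization, which acts on `E`.
  have hb : ∀ m : t, ∃ b : Unitization ℂ A,
      ∀ x : characterSpace ℂ (Unitization ℂ A), x b = (f m x : ℂ) := fun m => by
    obtain ⟨b, hb⟩ := (gelfandTransform_bijective (Unitization ℂ A)).2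
      ⟨fun x => (f m x : ℂ), by fun_prop⟩
    exact ⟨b, fun x => congr($hb x)⟩
  choose b hb using hb
  refine ⟨∑ m : t, ((b m).fst • (m : E) + (b m).snd • (m : E)), M.sum_mem fun m _ =>
    M.add_mem (M.smul_mem _ m.1.2) (hM _ _ m.1.2), ?_⟩
  rw [dist_eq_norm]
  refine lt_of_le_of_lt (norm_le_of_forall_norm_toFiber_le (A := A) hε.le fun x => ?_) hεδ
  have hsum : ∑ m : t, f m x = 1 := by
    rw [← finsum_eq_sum_of_fintype]
    exact f.sum_eq_one (Set.mem_univ x)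
  have hdecomp : toFiber (restrictCharacter x) E
      (e - ∑ m : t, ((b m).fst • (m : E) + (b m).snd • (m : E))) =
      ∑ m : t, (f m x : ℂ) • toFiber (restrictCharacter x) E (e - m) := by
    simp only [map_sub, map_sum, toFiber_unitization_smul, hb, smul_sub, Finset.sum_sub_distrib]
    rw [← Finset.sum_smul, ← Complex.ofReal_sum, hsum, Complex.ofReal_one, one_smul]
  rw [hdecomp]
  calc _ ≤ ∑ m : t, f m x * ε := norm_sum_le_of_le _ fun m _ => by
        rw [norm_smul, Complex.norm_real, Real.norm_of_nonneg (f.nonneg m x)]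
        rcases eq_or_ne (f m x) 0 with h0 | h0
        · simp [h0]
        · exact mul_le_mul_of_nonneg_left (hf m (subset_closure h0) : _ < ε).le (f.nonneg m x)
    _ = ε := by rw [← Finset.sum_mul, hsum, one_mul]

end Density

/-! ### Orthogonal sums of closed subspaces. -/

section Orthogonal

variable {A : Type*} [NonUnitalCommCStarAlgebra A] [PartialOrder A] [StarOrderedRing A]
  {E : Type*} [NormedAddCommGroup E] [NormedSpace ℂ E] [SMul A E] [CStarModule A E]

variable (A) in
theorem norm_le_norm_add_of_inner_eq_zero {u v : E} (h : ⟪u, v⟫_A = 0) : ‖u‖ ≤ ‖u + v‖ := by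
  have h' : ⟪v, u⟫_A = 0 := by rw [← CStarModule.star_inner, h, star_zero]
  rw [← sq_le_sq₀ (norm_nonneg _) (norm_nonneg _), CStarModule.norm_sq_eq A,
    CStarModule.norm_sq_eq A]
  refine CStarAlgebra.norm_le_norm_of_nonneg_of_le CStarModule.inner_self_nonneg ?_
  simpa [h, h'] using CStarModule.inner_self_nonneg (A := A) (x := v)

variable (A) in
/-- Orthogonal closed subspaces of a Hilbert module whose sum is dense span everything. -/
theorem sup_eq_top_of_dense_of_inner_eq_zero [CompleteSpace E] {M N : Submodule ℂ E}
    (hM : IsClosed (M : Set E)) (hN : IsClosed (N : Set E))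
    (h : ∀ u ∈ M, ∀ v ∈ N, ⟪u, v⟫_A = 0) (hd : Dense ((M ⊔ N : Submodule ℂ E) : Set E)) :
    M ⊔ N = ⊤ := by
  have := hM.completeSpace_coe
  have := hN.completeSpace_coe
  let s : M × N →L[ℂ] E := M.subtypeL.coprod N.subtypeL
  -- Orthogonality bounds each summand by the norm of the sum, so addition on `M × N` is bounded
  -- below and has closed range.
  have hs : AntilipschitzWith 1 s := AddMonoidHomClass.antilipschitz_of_bound s fun p => by
    have h₁ := h p.1 p.1.2 p.2 p.2.2
    have h₂ : ⟪(p.2 : E), (p.1 : E)⟫_A = 0 := by rw [← CStarModule.star_inner, h₁, star_zero]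
    rw [NNReal.coe_one, one_mul]
    refine max_le (norm_le_norm_add_of_inner_eq_zero A h₁) ?_
    have := norm_le_norm_add_of_inner_eq_zero A h₂
    rwa [add_comm] at this
  have hc := hs.isClosed_range s.uniformContinuous
  have hr : Set.range s = ((M ⊔ N : Submodule ℂ E) : Set E) := by
    ext u
    simp [s, Submodule.mem_sup]
  rw [hr] at hc
  exact SetLike.coe_injective (hc.closure_eq.symm.trans hd.closure_eq)

end Orthogonal

set_option linter.unusedSectionVars false

/-! ### Semiregular operators, their adjoints and graphs. -/

section Operators

variable {A : Type*} {E : Type*} [NonUnitalCommCStarAlgebra A] [PartialOrder A] [StarOrderedRing A]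
  [NormedAddCommGroup E] [NormedSpace ℂ E] [SMul A E] [CStarModule A E]

theorem eq_of_forall_mem_dense_inner_eq {S : Set E} (hS : Dense S) {u v : E}
    (h : ∀ x ∈ S, ⟪x, u⟫_A = ⟪x, v⟫_A) : u = v := by
  have hc : ∀ w : E, Continuous fun x : E => ⟪x, w⟫_A := fun w =>
    CStarModule.continuous_inner.comp (continuous_id.prodMk continuous_const)
  have hall : ∀ x : E, ⟪x, u⟫_A = ⟪x, v⟫_A :=
    congrFun ((hc u).ext_on hS (hc v) fun x hx => h x hx)
  rw [← sub_eq_zero, ← CStarModule.inner_self (A := A), CStarModule.inner_sub_right, hall, sub_self]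

variable (E) in
/-- The action of an element of `A` on a Hilbert module over `A`. -/
noncomputable def smulCLM (a : A) : E →L[ℂ] E :=
  LinearMap.mkContinuous
    { toFun := fun x => a • x
      -- `SMul` carries no axioms; linearity of the action is recovered from the inner product.
      map_add' := fun x y => eq_of_forall_mem_dense_inner_eq (A := A) dense_univ fun w _ => by
        simp [mul_add]
      map_smul' := fun c x => eq_of_forall_mem_dense_inner_eq (A := A) dense_univ fun w _ => by
        simp [mul_smul_comm] }
    ‖a‖ fun x => by
      change ‖a • x‖ ≤ ‖a‖ * ‖x‖
      rw [← sq_le_sq₀ (norm_nonneg _) (by positivity), mul_pow,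
        CStarModule.norm_sq_eq A (x := a • x), CStarModule.norm_sq_eq A (x := x),
        CStarModule.inner_op_smul_right, CStarModule.inner_op_smul_left]
      calc _ ≤ ‖a‖ * (‖⟪x, x⟫_A‖ * ‖star a‖) :=
            (norm_mul_le _ _).trans (mul_le_mul_of_nonneg_left (norm_mul_le _ _) (norm_nonneg _))
        _ = _ := by rw [norm_star]; ring

@[simp]
theorem smulCLM_apply (a : A) (x : E) : smulCLM E a x = a • x := rfl

theorem mem_adjointGraph {T : E →ₗ.[ℂ] E} {p : E × E} :
    p ∈ adjointGraph A T ↔ ∀ q ∈ T.graph, ⟪q.2, p.1⟫_A = ⟪q.1, p.2⟫_A := by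
  constructor
  · rintro h ⟨u, v⟩ hq
    obtain ⟨x, rfl, rfl⟩ := (LinearPMap.mem_graph_iff T).mp hq
    exact h x
  · exact fun h x => h _ (T.mem_graph x)

variable (A) in
theorem isClosed_adjointGraph (T : E →ₗ.[ℂ] E) :
    IsClosed (adjointGraph A T : Set (E × E)) := by
  have hset : (adjointGraph A T : Set (E × E)) =
      ⋂ x : T.domain, {p | ⟪T x, p.1⟫_A = ⟪(x : E), p.2⟫_A} := by
    ext p
    simp only [Set.mem_iInter]
    rfl
  rw [hset]
  exact isClosed_iInter fun x => isClosed_eq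
    (CStarModule.continuous_inner.comp (continuous_const.prodMk continuous_fst))
    (CStarModule.continuous_inner.comp (continuous_const.prodMk continuous_snd))

theorem mem_adjoint_domain {T : E →ₗ.[ℂ] E} {y : E} :
    y ∈ (adjoint A T).domain ↔ ∃ z, (y, z) ∈ adjointGraph A T := by
  simp [adjoint, Submodule.toLinearPMap_domain]

theorem graph_adjoint {T : E →ₗ.[ℂ] E} (hT : Dense (T.domain : Set E)) :
    (adjoint A T).graph = adjointGraph A T := by
  refine Submodule.toLinearPMap_graph_eq _ fun p hp hp₁ => ?_
  refine eq_of_forall_mem_dense_inner_eq (A := A) hT fun x hx => ?_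
  rw [← hp ⟨x, hx⟩, hp₁, CStarModule.inner_zero_right, CStarModule.inner_zero_right]

theorem smul_mem_adjointGraph {T : E →ₗ.[ℂ] E} {p : E × E} (a : A) (hp : p ∈ adjointGraph A T) :
    (a • p.1, a • p.2) ∈ adjointGraph A T := fun x => by
  simp [hp x]

namespace IsSemiregular

variable {T : E →ₗ.[ℂ] E}

/-- A vector is determined by its inner products with the domain of the adjoint. -/
theorem eq_of_forall_mem_adjointGraph (hT : IsSemiregular A T) {u v : E}
    (h : ∀ p ∈ adjointGraph A T, ⟪u, p.1⟫_A = ⟪v, p.1⟫_A) : u = v := by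
  refine eq_of_forall_mem_dense_inner_eq (A := A) hT.dense_adjoint_domain fun y hy => ?_
  obtain ⟨z, hz⟩ := mem_adjoint_domain.mp hy
  rw [← CStarModule.star_inner u, h _ hz, CStarModule.star_inner]

/-- `A`-linearity of `T` is not assumed: it is forced by pairing with the dense domain of the
adjoint. -/
theorem smul_mem_graph (hT : IsSemiregular A T) {p : E × E} (a : A) (hp : p ∈ T.graph) :
    (a • p.1, a • p.2) ∈ T.graph := by
  obtain ⟨x, hx₁, hx₂⟩ := (LinearPMap.mem_graph_iff T).mp hp
  have hax : a • p.1 ∈ T.domain := hT.smul_mem a _ (hx₁ ▸ x.2)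
  refine (LinearPMap.mem_graph_iff T).mpr ⟨⟨_, hax⟩, rfl, ?_⟩
  refine hT.eq_of_forall_mem_adjointGraph fun q hq => ?_
  rw [hq, ← hx₂, CStarModule.inner_op_smul_left, CStarModule.inner_op_smul_left, hq, hx₁]

/-- The adjoint relation passes to limits, so if `(0, v)` lies in the closed graph, `v` is
orthogonal to the dense domain of `T*`. -/
theorem isClosable (hT : IsSemiregular A T) : T.IsClosable := by
  refine ⟨_, (Submodule.toLinearPMap_graph_eq T.graph.topologicalClosure fun p hp hp₁ => ?_).symm⟩
  refine hT.eq_of_forall_mem_adjointGraph fun q hq => ?_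
  have hclosed : IsClosed {p : E × E | ⟪p.2, q.1⟫_A = ⟪p.1, q.2⟫_A} := isClosed_eq
    (CStarModule.continuous_inner.comp (continuous_snd.prodMk continuous_const))
    (CStarModule.continuous_inner.comp (continuous_fst.prodMk continuous_const))
  have hmem := closure_minimal (fun r hr => mem_adjointGraph.mp hq r hr) hclosed hp
  rw [hmem, hp₁, CStarModule.inner_zero_left, CStarModule.inner_zero_left]

theorem adjointGraph_closure (hT : IsSemiregular A T) :
    adjointGraph A T.closure = adjointGraph A T := by
  ext q
  rw [mem_adjointGraph, mem_adjointGraph, ← hT.isClosable.graph_closure_eq_closure_graph]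
  refine ⟨fun h p hp => h p (T.graph.le_topologicalClosure hp), fun h p hp => ?_⟩
  have hclosed : IsClosed {p : E × E | ⟪p.2, q.1⟫_A = ⟪p.1, q.2⟫_A} := isClosed_eq
    (CStarModule.continuous_inner.comp (continuous_snd.prodMk continuous_const))
    (CStarModule.continuous_inner.comp (continuous_fst.prodMk continuous_const))
  exact closure_minimal h hclosed hp

theorem closure (hT : IsSemiregular A T) : IsSemiregular A T.closure where
  smul_mem a x hx := by
    have hp := T.closure.mem_graph ⟨x, hx⟩
    rw [← hT.isClosable.graph_closure_eq_closure_graph] at hp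
    have hq : (a • x, a • T.closure ⟨x, hx⟩) ∈ T.closure.graph := by
      rw [← hT.isClosable.graph_closure_eq_closure_graph]
      exact map_mem_closure (f := (smulCLM E a).prodMap (smulCLM E a))
        (ContinuousLinearMap.continuous _) hp fun p hp => hT.smul_mem_graph a hp
    exact LinearPMap.mem_domain_of_mem_graph hq
  dense_domain := hT.dense_domain.mono T.le_closure.1
  dense_adjoint_domain := by
    rw [adjoint, hT.adjointGraph_closure]
    exact hT.dense_adjoint_domain

end IsSemiregular

variable (A) in
/-- The graph of `T` in the Hilbert module `E × E`. -/
def graphModule (T : E →ₗ.[ℂ] E) : Submodule ℂ (WithCStarModule A (E × E)) :=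
  T.graph.comap (WithCStarModule.linearEquiv ℂ A (E × E)).toLinearMap

variable (A) in
/-- The rotated graph `{(T* y, -y)}` of the adjoint of `T` in the Hilbert module `E × E`. -/
def rotatedAdjointGraph (T : E →ₗ.[ℂ] E) : Submodule ℂ (WithCStarModule A (E × E)) :=
  (adjointGraph A T).comap
    ((LinearMap.prod (-LinearMap.snd ℂ E E) (LinearMap.fst ℂ E E)) ∘ₗ
      (WithCStarModule.linearEquiv ℂ A (E × E)).toLinearMap)

theorem mem_graphModule {T : E →ₗ.[ℂ] E} {w : WithCStarModule A (E × E)} :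
    w ∈ graphModule A T ↔ (w.1, w.2) ∈ T.graph := Iff.rfl

theorem mem_rotatedAdjointGraph {T : E →ₗ.[ℂ] E} {w : WithCStarModule A (E × E)} :
    w ∈ rotatedAdjointGraph A T ↔ (-w.2, w.1) ∈ adjointGraph A T := Iff.rfl

theorem isClosed_graphModule {T : E →ₗ.[ℂ] E} (hT : T.IsClosed) :
    IsClosed (graphModule A T : Set (WithCStarModule A (E × E))) :=
  IsClosed.preimage (WithCStarModule.uniformEquiv (A := A) (E := E × E)).continuous hT

variable (A) in
theorem isClosed_rotatedAdjointGraph (T : E →ₗ.[ℂ] E) :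
    IsClosed (rotatedAdjointGraph A T : Set (WithCStarModule A (E × E))) :=
  ((isClosed_adjointGraph A T).preimage (continuous_snd.neg.prodMk continuous_fst)).preimage
    (WithCStarModule.uniformEquiv (A := A) (E := E × E)).continuous

theorem inner_eq_zero_of_mem_graphModule {T : E →ₗ.[ℂ] E} {u v : WithCStarModule A (E × E)}
    (hu : u ∈ graphModule A T) (hv : v ∈ rotatedAdjointGraph A T) : ⟪u, v⟫_A = 0 := by
  have h := mem_adjointGraph.mp (mem_rotatedAdjointGraph.mp hv) _ (mem_graphModule.mp hu)
  rw [CStarModule.inner_neg_right] at h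
  rw [WithCStarModule.prod_inner, ← h, neg_add_cancel]

theorem smul_mem_graph_sup {T : E →ₗ.[ℂ] E} (hT : IsSemiregular A T) (a : A)
    {u : WithCStarModule A (E × E)} (hu : u ∈ graphModule A T ⊔ rotatedAdjointGraph A T) :
    a • u ∈ graphModule A T ⊔ rotatedAdjointGraph A T := by
  obtain ⟨m, hm, n, hn, rfl⟩ := Submodule.mem_sup.mp hu
  rw [← smulCLM_apply, map_add]
  refine Submodule.add_mem_sup ?_ ?_
  · exact hT.smul_mem_graph a hm
  · have h := smul_mem_adjointGraph a (mem_rotatedAdjointGraph.mp hn)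
    rw [mem_rotatedAdjointGraph]
    have hneg : a • (-n.2) = -(a • n.2) := map_neg (smulCLM E a) n.2
    rwa [hneg] at h

/-- On each localization the graph of `T` and the rotated graph of its adjoint span everything. -/
theorem map_toFiber_graph_sup_eq_top {T : E →ₗ.[ℂ] E} (hT : IsSemiregular A T)
    (χ : A →⋆ₙₐ[ℂ] ℂ) [FiniteDimensional ℂ (Fiber χ E)]
    [FiniteDimensional ℂ (Fiber χ (WithCStarModule A (E × E)))] :
    (graphModule A T ⊔ rotatedAdjointGraph A T).map (toFiber χ (WithCStarModule A (E × E))) = ⊤ := by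
  rw [← Submodule.orthogonal_eq_bot_iff, Submodule.eq_bot_iff]
  intro v hv
  obtain ⟨w, rfl⟩ := toFiber_surjective χ v
  have horth : ∀ m ∈ graphModule A T ⊔ rotatedAdjointGraph A T,
      ⟪toFiber χ E m.1, toFiber χ E w.1⟫_ℂ + ⟪toFiber χ E m.2, toFiber χ E w.2⟫_ℂ = 0 := by
    intro m hm
    have h := (Submodule.mem_orthogonal _ _).mp hv _ (Submodule.mem_map_of_mem hm)
    rwa [inner_toFiber, WithCStarModule.prod_inner, map_add] at h
  obtain ⟨x, hx, hxw⟩ := (map_toFiber_eq_top_of_dense χ hT.dense_domain).ge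
    (Submodule.mem_top (x := toFiber χ E w.1))
  -- Tested against the pairs `(T* y, -y)`, whose `y` fill the fibre.
  have hw₂ : toFiber χ E w.2 = toFiber χ E (T ⟨x, hx⟩) := by
    refine ext_inner_left ℂ fun v => ?_
    obtain ⟨y, hy, rfl⟩ := (map_toFiber_eq_top_of_dense χ hT.dense_adjoint_domain).ge
      (Submodule.mem_top (x := v))
    obtain ⟨z, hz⟩ := mem_adjoint_domain.mp hy
    have h := horth ((WithCStarModule.equiv A (E × E)).symm (z, -y)) (Submodule.mem_sup_right
      (mem_rotatedAdjointGraph.mpr (by simpa using hz)))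
    have hadj : ⟪y, T ⟨x, hx⟩⟫_A = ⟪z, x⟫_A := by
      rw [← CStarModule.star_inner, hz ⟨x, hx⟩, CStarModule.star_inner]
    simp only [WithCStarModule.equiv_symm_fst, WithCStarModule.equiv_symm_snd, map_neg,
      inner_neg_left, ← hxw] at h
    rw [inner_toFiber χ y (T _), hadj, ← inner_toFiber]
    exact (add_neg_eq_zero.mp h).symm
  -- In the fibre `w` now agrees with a graph element, hence is orthogonal to itself.
  have h := horth ((WithCStarModule.equiv A (E × E)).symm (x, T ⟨x, hx⟩))
    (Submodule.mem_sup_left (T.mem_graph ⟨x, hx⟩))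
  rw [WithCStarModule.equiv_symm_fst, WithCStarModule.equiv_symm_snd, hxw, ← hw₂, inner_toFiber,
    inner_toFiber, ← map_add, ← WithCStarModule.prod_inner, ← inner_toFiber] at h
  exact inner_self_eq_zero.mp h

variable [CompleteSpace E]

theorem graph_sup_eq_top (hE : IsFinitelyGenerated A E) {T : E →ₗ.[ℂ] E} (hT : IsSemiregular A T)
    (hc : T.IsClosed) : graphModule A T ⊔ rotatedAdjointGraph A T = ⊤ := by
  refine sup_eq_top_of_dense_of_inner_eq_zero A (isClosed_graphModule hc)
    (isClosed_rotatedAdjointGraph A T) (fun u hu v hv => inner_eq_zero_of_mem_graphModule hu hv) ?_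
  refine dense_of_forall_map_toFiber_eq_top (fun a u hu => smul_mem_graph_sup hT a hu) fun χ => ?_
  obtain ⟨n, f, hf⟩ := hE
  have : FiniteDimensional ℂ (Submodule.span ℂ (Set.range f)) :=
    FiniteDimensional.span_of_finite ℂ (Set.finite_range f)
  have hW := map_toFiber_span_eq_top χ hf
  have : FiniteDimensional ℂ (Fiber χ E) := by
    refine Module.Finite.of_surjective ((toFiber χ E).domRestrict (Submodule.span ℂ (Set.range f)))
      (LinearMap.range_eq_top.mp ?_)
    rw [LinearMap.range_domRestrict, hW]
  have := finiteDimensional_fiber_prod χ hW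
  exact map_toFiber_graph_sup_eq_top hT χ

theorem IsSemiregular.isRegular (hE : IsFinitelyGenerated A E) {T : E →ₗ.[ℂ] E}
    (hT : IsSemiregular A T) (hc : T.IsClosed) : IsRegular A T where
  isClosed := hc
  isSemiregular := hT
  dense_range := by
    suffices h : rangeOneAddAdjointComp A T = Set.univ by rw [h]; exact dense_univ
    refine Set.eq_univ_of_forall fun w => ?_
    -- Writing `(w, 0) = (x, T x) + (T* y, -y)` forces `y = T x`, so `w = x + T* T x`.
    obtain ⟨m, hm, n, hn, hmn⟩ := Submodule.mem_sup.mp ((graph_sup_eq_top hE hT hc).ge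
      (Submodule.mem_top (x := (WithCStarModule.equiv A (E × E)).symm (w, 0))))
    have h₁ : m.1 + n.1 = w := congr($(hmn).1)
    have h₂ : m.2 + n.2 = 0 := congr($(hmn).2)
    obtain ⟨x, hx₁, hx₂⟩ := (LinearPMap.mem_graph_iff T).mp (mem_graphModule.mp hm)
    rw [mem_rotatedAdjointGraph, ← eq_neg_of_add_eq_zero_left h₂] at hn
    change T x = m.2 at hx₂
    rw [← hx₂, ← graph_adjoint hT.dense_domain] at hn
    have hdom := LinearPMap.mem_domain_of_mem_graph hn
    refine ⟨x, hdom, ?_⟩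
    rw [← (LinearPMap.image_iff hdom).mpr hn, hx₁, h₁]

end Operators

end HilbertModule

theorem theorem5 {A E : Type*} [NonUnitalCommCStarAlgebra A] [PartialOrder A] [StarOrderedRing A]
    [NormedAddCommGroup E] [NormedSpace ℂ E] [SMul A E] [CStarModule A E] [CompleteSpace E]
    (hE : HilbertModule.IsFinitelyGenerated A E)
    (T : E →ₗ.[ℂ] E) (hT : HilbertModule.IsSemiregular A T) :
    T.IsClosable ∧ HilbertModule.IsRegular A T.closure ∧
      (T.IsClosed → HilbertModule.IsRegular A T) :=
  ⟨hT.isClosable, hT.closure.isRegular hE hT.isClosable.closure_isClosed, hT.isRegular hE⟩
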